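/- Let $n\ge 0$ and $k\ge 2$ be integers and let $\binom{[n]}{k}$ be the set of $k$-element subsets of $[n]=\{1,\dots,n\}$. For $i\ge 0$ let $D_i$ be the real matrix with rows and columns indexed by $\binom{[n]}{k}$ and entries $(D_i)_{A,B}=\binom{|A\setminus B|}{i}$, and for $1\le t\le k$ let $$A_t=\sum_{i=0}^{t-1}(-1)^{t-1-i}\binom{k-1-i}{k-t}\binom{n-k-t+i}{k-t}^{-1}D_{k-i}$$ be Wilson's matrix, where a summand with $D_{k-i}=0$ is read as $0$ (this is the case whenever $n-k-t+i<k-t$). Let $J$ be the all-ones matrix of the same size, and let $$M=J-\binom{n-2}{k-2}A_2 .$$ Let $G(n,k,1)$ be the graph with vertex set $\binom{[n]}{k}$ in which $A\ne B$ are adjacent if and only if $|A\cap B|=1$. For a finite nonempty graph $G=(V,E)$, call a real $V\times V$ matrix $X$ feasible for $\vartheta'(G)$ if $X$ is symmetric and $X_{ij}\ge 1$ for all $i,j\in V$ (including $i=j$) that are not adjacent in $G$, and let $\vartheta'(G)$ be the minimum, over all feasible $X$, of the largest eigenvalue of $X$. Then: 1. If $n\le k^2-k+1$, then $M_{A,B}\ge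 1$ for all $A,B\in\binom{[n]}{k}$ with $|A\cap B|\ne 1$. 2. If $n\ge 3k-3$, then the largest eigenvalue of $M$ is $\binom{n-2}{k-2}$. 3. Consequently, if $n\le k^2-k+1$, then $M$ is feasible for $\vartheta'(G(n,k,1))$, and if $3k-3\le n\le k^2-k+1$, then $\vartheta'(G(n,k,1))\le\binom{n-2}{k-2}$. -/

import Mathlib

/-- The `k`-element subsets of an `n`-element set. -/
abbrev KSubset (n k : ℕ) : Type := {s : Finset (Fin n) // s.card = k}

/-- The generalized Johnson graph `G(n, k, L)`, for `L ⊆ {0, …, k-1}`: distinct `k`-subsets are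
adjacent when the size of their intersection is not in `L`. -/
def generalizedJohnsonGraph (n k : ℕ) (L : Set ℕ) : SimpleGraph (KSubset n k) where
  Adj A B := A ≠ B ∧ (A.1 ∩ B.1).card ∉ L
  symm := ⟨fun A B h => ⟨h.1.symm, by rw [Finset.inter_comm]; exact h.2⟩⟩
  loopless := ⟨fun _ h => h.1 rfl⟩

/-- The graph `G(n, k, ℓ) = G(n, k, {0, …, k-1} \ {ℓ})`. -/
def singleJohnsonGraph (n k l : ℕ) : SimpleGraph (KSubset n k) :=
  generalizedJohnsonGraph n k (Set.Iio k \ {l})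

/-- `c` is the largest (real) eigenvalue of the real matrix `A`. -/
def IsLargestEigenvalue {V : Type*} [Fintype V] [DecidableEq V] (A : Matrix V V ℝ) (c : ℝ) :
    Prop :=
  IsGreatest {μ : ℝ | Module.End.HasEigenvalue (Matrix.toLin' A) μ} c

/-- `A` is feasible in the minimization that defines the Delsarte number of `G`: it is symmetric,
and its entries at equal or non-adjacent pairs of vertices are at least `1`. -/
def IsDelsarteFeasible {V : Type*} (G : SimpleGraph V) (A : Matrix V V ℝ) : Prop :=
  A.IsSymm ∧ ∀ i j, ¬ G.Adj i j → 1 ≤ A i j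

/-- The Delsarte number (Schrijver's variant of the Lovász number) `ϑ'(G)` of a finite graph with
at least one vertex: the least largest eigenvalue of a feasible matrix. -/
noncomputable def delsarteNumber {V : Type*} [Fintype V] [DecidableEq V] (G : SimpleGraph V) : ℝ :=
  sInf {c : ℝ | ∃ A : Matrix V V ℝ, IsDelsarteFeasible G A ∧ IsLargestEigenvalue A c}

/-- The matrix `D_i`, with `(A, B)` entry the binomial coefficient `|A \ B|` choose `i`. -/
def diffMatrix (n k i : ℕ) : Matrix (KSubset n k) (KSubset n k) ℝ :=
  Matrix.of fun A B => (((A.1 \ B.1).card.choose i : ℕ) : ℝ)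

/-- Wilson's matrix `A_t`, for `1 ≤ t ≤ k`. When `n - k - t + i < k - t`, so that the inverted
binomial coefficient may be zero or its upper index negative (and then truncated), one has
`n - k < k - i`, hence `D_{k-i} = 0` and the summand is zero. -/
noncomputable def wilsonMatrix (n k t : ℕ) : Matrix (KSubset n k) (KSubset n k) ℝ :=
  ∑ i ∈ Finset.range t,
    ((-1 : ℝ) ^ (t - 1 - i) * ((k - 1 - i).choose (k - t) : ℝ) *
      ((n + i - k - t).choose (k - t) : ℝ)⁻¹) • diffMatrix n k (k - i)

/-!
The matrix `M` is a combination of the matrices `D_0` (the all-ones matrix), `D_{k-1}` and `D_k`.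

Entries: `D_{k-1}` and `D_k` vanish at `(A, B)` when `|A ∩ B| ≥ 2`, so that `M` has entry `1` there.
The only other entry to check is the one at disjoint pairs, where `1 ≤ M A B` simplifies to
`n ≤ k ^ 2 - k + 1` (`one_le_apply`).

Eigenvalues: instead of decomposing the functions on `k`-subsets into the eigenspaces of the Johnson
scheme, filter them by degree, with the functions `e_S : A ↦ [S ⊆ A]`, `|S| ≤ j`, spanning degree at
most `j`. A double count and inclusion–exclusion show that `D_s e_S` is a multiple of `e_S`, by a
factor depending on `|S|` only, plus functions of lower degree
(`diffMatrix_mulVec_containIndicator_sub_mem`). Hence `M` is triangular, and each of its eigenvalues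
is one of the diagonal factors (`Module.End.HasEigenvalue.exists_eq_of_filtration`). The factor in
degree `0` is `(n - 2).choose (k - 2)`, with the constants as eigenvectors, and the other ones are at
most this number because the corresponding eigenvalues of `A_2` are at least `-1`
(`neg_one_le_wilsonEigenvalue`), which is where `3 * k - 3 ≤ n` enters. For `n ≥ 2 * k` everything is
expressed in `K = k - 2` and `L = n - 2 * k`; the one case with `3 * k - 3 ≤ n < 2 * k` is covered by
`M = 1` for `k = 2`.

Delsarte number: feasible matrices have diagonal entries at least `1`, so their largest eigenvalues
are bounded below (`one_le_of_isLargestEigenvalue`), and the infimum is at most the largest eigenvalue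
of the feasible matrix `M`.
-/

open Finset Matrix

/-! ### Counting subsets -/

theorem card_filter_subset_powersetCard {α : Type*} [DecidableEq α] {S X : Finset α} {k : ℕ}
    (hS : S ⊆ X) (hk : k ≤ #X) :
    #{B ∈ X.powersetCard k | S ⊆ B} = (#X - #S).choose (#X - k) := by
  rw [← card_sdiff_of_subset hS, ← card_powersetCard]
  -- Complementation in `X` turns the sets containing `S` into the subsets of `X \ S`.
  refine card_bij' (fun B _ => X \ B) (fun B _ => X \ B) ?_ ?_ ?_ ?_
  · intro B hB
    simp only [mem_filter, mem_powersetCard] at hB ⊢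
    exact ⟨sdiff_subset_sdiff le_rfl hB.2, by rw [card_sdiff_of_subset hB.1.1, hB.1.2]⟩
  · intro B hB
    simp only [mem_filter, mem_powersetCard] at hB ⊢
    refine ⟨⟨sdiff_subset, ?_⟩, ?_⟩
    · rw [card_sdiff_of_subset (hB.1.trans sdiff_subset), hB.2]; omega
    · intro x hx
      exact mem_sdiff.2 ⟨hS hx, fun h => (mem_sdiff.1 (hB.1 h)).2 hx⟩
  · intro B hB
    simp only [mem_filter, mem_powersetCard] at hB
    simpa using hB.1.1
  · intro B hB
    simp only [mem_powersetCard] at hB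
    simpa using hB.1.trans sdiff_subset

/-- Inclusion–exclusion over `S` for the number of `s`-subsets of `A` that are disjoint from `S`. -/
theorem sum_powerset_neg_one_pow_mul_choose {α : Type*} [DecidableEq α] {A : Finset α}
    (S : Finset α) {s : ℕ} (hs : s ≤ #A) :
    ∑ T ∈ S.powerset, (-1 : ℝ) ^ #T * (#A - #T).choose (#A - s) * (if T ⊆ A then 1 else 0) =
      (#(A \ S)).choose s := by
  have h1 : ∀ T ∈ S.powerset,
      (-1 : ℝ) ^ #T * (#A - #T).choose (#A - s) * (if T ⊆ A then 1 else 0) =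
        ∑ R ∈ A.powersetCard s, if T ⊆ R then (-1 : ℝ) ^ #T else 0 := by
    intro T _
    rw [← sum_filter, sum_const, nsmul_eq_mul]
    split_ifs with h
    · rw [card_filter_subset_powersetCard h hs]; ring
    · rw [filter_false_of_mem]
      · simp
      · exact fun R hR hTR => h (hTR.trans (mem_powersetCard.1 hR).1)
  -- The alternating sum over the subsets of `R ∩ S` vanishes unless `R ∩ S` is empty.
  rw [sum_congr rfl h1, sum_comm, ← card_powersetCard]
  have h2 : ∀ R ∈ A.powersetCard s,
      (∑ T ∈ S.powerset, if T ⊆ R then (-1 : ℝ) ^ #T else 0) = if Disjoint R S then 1 else 0 := by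
    intro R _
    have h3 : S.powerset.filter (· ⊆ R) = (R ∩ S).powerset := by
      ext T
      simp only [mem_filter, mem_powerset, subset_inter_iff]
      tauto
    rw [← sum_filter, h3]
    have := congrArg (Int.cast : ℤ → ℝ) (sum_powerset_neg_one_pow_card (x := R ∩ S))
    push_cast at this
    simpa [disjoint_iff_inter_eq_empty] using this
  rw [sum_congr rfl h2, ← sum_filter, sum_const, nsmul_eq_mul, mul_one]
  congr 2
  ext R
  simp only [mem_filter, mem_powersetCard, subset_sdiff]
  tauto

/-! ### The degree filtration -/

/-- The function `A ↦ [S ⊆ A]` on `k`-subsets. -/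
def containIndicator (n k : ℕ) (S : Finset (Fin n)) : KSubset n k → ℝ :=
  fun A => if S ⊆ A.1 then 1 else 0

/-- The functions on `k`-subsets of degree less than `j`, that is, the span of the functions
`A ↦ [S ⊆ A]` with `|S| < j`. -/
def degreeLTSubmodule (n k j : ℕ) : Submodule ℝ (KSubset n k → ℝ) :=
  Submodule.span ℝ (containIndicator n k '' {S | #S < j})

theorem containIndicator_mem {n k j : ℕ} {S : Finset (Fin n)} (h : #S < j) :
    containIndicator n k S ∈ degreeLTSubmodule n k j :=
  Submodule.subset_span ⟨S, h, rfl⟩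

theorem degreeLTSubmodule_mono (n k : ℕ) : Monotone (degreeLTSubmodule n k) :=
  fun _ _ h => Submodule.span_mono (Set.image_mono fun _ hS => lt_of_lt_of_le hS h)

theorem degreeLTSubmodule_zero (n k : ℕ) : degreeLTSubmodule n k 0 = ⊥ := by
  simp [degreeLTSubmodule]

/-- The indicator of a single `k`-set `A` is `containIndicator n k A`, so that every function has
degree at most `k`. -/
theorem degreeLTSubmodule_eq_top (n k : ℕ) : degreeLTSubmodule n k (k + 1) = ⊤ := by
  rw [eq_top_iff, ← (Pi.basisFun ℝ (KSubset n k)).span_eq, Submodule.span_le]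
  rintro _ ⟨A, rfl⟩
  have : (Pi.basisFun ℝ (KSubset n k)) A = containIndicator n k A.1 := by
    ext B
    have : A.1 ⊆ B.1 ↔ B = A := by
      refine ⟨fun h => Subtype.ext (eq_of_subset_of_card_le h ?_).symm, fun h => h ▸ le_rfl⟩
      rw [A.2, B.2]
    simp [containIndicator, this, Pi.single_apply]
  rw [this]
  exact containIndicator_mem (by rw [A.2]; omega)

/-- The value at `A` counts the pairs of an `s`-subset `R` of `A` and a `k`-set `B ⊇ S` disjoint from
`R`. For each `R` disjoint from `S` the number of such `B` depends on `|S|` only, and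
inclusion–exclusion expands the number of such `R` in the functions `containIndicator n k T`. -/
theorem diffMatrix_mulVec_containIndicator {n k s : ℕ} (hs : s ≤ k) (hn : s + k ≤ n)
    (S : Finset (Fin n)) :
    diffMatrix n k s *ᵥ containIndicator n k S =
      ∑ T ∈ S.powerset, ((-1 : ℝ) ^ #T * (k - #T).choose (k - s) *
        (n - s - #S).choose (n - s - k)) • containIndicator n k T := by
  ext A
  have hA := A.2
  have key := sum_powerset_neg_one_pow_mul_choose (A := A.1) S (s := s) (by omega)
  rw [hA] at key
  have hrhs : (∑ T ∈ S.powerset, ((-1 : ℝ) ^ #T * (k - #T).choose (k - s) *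
        (n - s - #S).choose (n - s - k)) • containIndicator n k T) A =
      (#(A.1 \ S)).choose s * (n - s - #S).choose (n - s - k) := by
    rw [← key, sum_mul, Finset.sum_apply]
    refine sum_congr rfl fun T _ => ?_
    simp only [containIndicator, Pi.smul_apply, smul_eq_mul]
    ring
  rw [hrhs]
  have h1 : ∀ B : KSubset n k, diffMatrix n k s A B * containIndicator n k S B =
      ∑ R ∈ A.1.powersetCard s, if Disjoint R B.1 ∧ S ⊆ B.1 then (1 : ℝ) else 0 := by
    intro B
    have : (A.1.powersetCard s).filter (fun R => Disjoint R B.1) = (A.1 \ B.1).powersetCard s := by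
      ext R
      simp only [mem_filter, mem_powersetCard, subset_sdiff]
      tauto
    by_cases h : S ⊆ B.1
    · simp only [h, and_true, diffMatrix, containIndicator, of_apply, if_true, mul_one]
      rw [← sum_filter, this]
      simp
    · simp [h, containIndicator]
  simp only [mulVec, dotProduct]
  rw [sum_congr rfl fun B _ => h1 B, sum_comm]
  have h2 : ∀ R ∈ A.1.powersetCard s,
      (∑ B : KSubset n k, if Disjoint R B.1 ∧ S ⊆ B.1 then (1 : ℝ) else 0) =
        if Disjoint R S then ((n - s - #S).choose (n - s - k) : ℝ) else 0 := by
    intro R hR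
    have hRs := (mem_powersetCard.1 hR).2
    have hcR : #Rᶜ = n - s := by rw [card_compl, hRs, Fintype.card_fin]
    split_ifs with h
    · have hSR : S ⊆ Rᶜ := subset_compl_iff_disjoint_left.2 h
      have := card_filter_subset_powersetCard (k := k) hSR (by omega)
      rw [hcR] at this
      rw [← this, ← sum_filter, sum_const, nsmul_eq_mul, mul_one]
      congr 1
      refine card_bij (fun B _ => B.1) ?_ ?_ ?_
      · intro B hB
        simp only [mem_filter, mem_univ, true_and, mem_powersetCard] at hB ⊢
        exact ⟨⟨subset_compl_iff_disjoint_left.2 hB.1, B.2⟩, hB.2⟩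
      · exact fun _ _ _ _ h => Subtype.ext h
      · intro B hB
        simp only [mem_filter, mem_powersetCard] at hB
        exact ⟨⟨B, hB.1.2⟩, by simpa using ⟨subset_compl_iff_disjoint_left.1 hB.1.1, hB.2⟩, rfl⟩
    · refine sum_eq_zero fun B _ => if_neg fun hB => h (hB.1.mono_right hB.2)
  rw [sum_congr rfl h2, ← sum_filter, sum_const, nsmul_eq_mul, ← card_powersetCard]
  congr 3
  ext R
  simp only [mem_filter, mem_powersetCard, subset_sdiff]
  tauto

/-- The eigenvalue of `diffMatrix n k s` on the functions of degree `j` modulo those of lower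
degree. -/
noncomputable def diffEigenvalue (n k s j : ℕ) : ℝ :=
  (-1) ^ j * (k - j).choose (k - s) * (n - s - j).choose (n - s - k)

/-- Only `T = S` contributes a term of degree `|S|` in `diffMatrix_mulVec_containIndicator`. -/
theorem diffMatrix_mulVec_containIndicator_sub_mem {n k s : ℕ} (hs : s ≤ k) (hn : s + k ≤ n)
    (S : Finset (Fin n)) :
    diffMatrix n k s *ᵥ containIndicator n k S -
      diffEigenvalue n k s #S • containIndicator n k S ∈ degreeLTSubmodule n k #S := by
  rw [diffMatrix_mulVec_containIndicator hs hn, ← sum_erase_add _ _ (mem_powerset_self S),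
    diffEigenvalue, add_sub_cancel_right]
  refine Submodule.sum_mem _ fun T hT => Submodule.smul_mem _ _ (containIndicator_mem ?_)
  rw [mem_erase, mem_powerset] at hT
  exact card_lt_card (hT.2.ssubset_of_ne hT.1)

/-- An endomorphism that acts on the successive quotients of a filtration as scalars has no
eigenvalues other than these scalars. -/
theorem Module.End.HasEigenvalue.exists_eq_of_filtration {V : Type*} [AddCommGroup V] [Module ℝ V]
    {f : Module.End ℝ V} {U : ℕ → Submodule ℝ V} {m : ℕ} {c : ℕ → ℝ} (h0 : U 0 = ⊥)
    (hm : U m = ⊤) (hf : ∀ j < m, ∀ x ∈ U (j + 1), f x - c j • x ∈ U j) {μ : ℝ}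
    (hμ : f.HasEigenvalue μ) : ∃ j < m, μ = c j := by
  obtain ⟨v, hv⟩ := hμ.exists_hasEigenvector
  by_contra! hne
  -- Each step down multiplies `v` by `μ - c j ≠ 0` modulo the next term of the filtration.
  have : ∀ i ≤ m, v ∈ U (m - i) := by
    intro i
    induction i with
    | zero => simp [hm]
    | succ i ih =>
      intro hi
      have hlt : m - (i + 1) < m := by omega
      have := hf _ hlt v (by convert ih (by omega) using 2; omega)
      rw [hv.apply_eq_smul, ← sub_smul] at this
      exact (Submodule.smul_mem_iff _ (sub_ne_zero.2 (hne _ hlt))).1 this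
  have := this m le_rfl
  rw [Nat.sub_self, h0, Submodule.mem_bot] at this
  exact hv.2 this

/-- For a matrix that is triangular with respect to the degree, it suffices to know its action on
the spanning functions `containIndicator n k S`. -/
theorem mulVec_sub_smul_mem_degreeLTSubmodule {n k : ℕ} {M : Matrix (KSubset n k) (KSubset n k) ℝ}
    {c : ℕ → ℝ} (hM : ∀ S : Finset (Fin n), M *ᵥ containIndicator n k S -
      c #S • containIndicator n k S ∈ degreeLTSubmodule n k #S) {j : ℕ} {x : KSubset n k → ℝ}
    (hx : x ∈ degreeLTSubmodule n k (j + 1)) : M *ᵥ x - c j • x ∈ degreeLTSubmodule n k j := by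
  induction hx using Submodule.span_induction with
  | mem x hx =>
    obtain ⟨S, hS, rfl⟩ := hx
    rcases (Nat.lt_succ_iff.1 hS).lt_or_eq with h | h
    · have h1 := degreeLTSubmodule_mono n k h.le (hM S)
      have h2 := containIndicator_mem (k := k) h
      have h3 := add_mem h1 (Submodule.smul_mem _ (c #S - c j) h2)
      convert h3 using 1
      module
    · exact h ▸ hM S
  | zero => simp
  | add x y _ _ hx hy =>
    convert add_mem hx hy using 1
    rw [mulVec_add]; module
  | smul a x _ hx =>
    convert Submodule.smul_mem _ a hx using 1
    rw [mulVec_smul]; module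

/-! ### Entries of the matrix -/

theorem diffMatrix_isSymm (n k i : ℕ) : (diffMatrix n k i).IsSymm := by
  ext A B
  have h : #(B.1 \ A.1) = #(A.1 \ B.1) := by
    have h1 := card_sdiff_add_card_inter A.1 B.1
    have h2 := card_sdiff_add_card_inter B.1 A.1
    rw [inter_comm, B.2] at h2
    rw [A.2] at h1
    omega
  simp [diffMatrix, h]

theorem diffMatrix_zero (n k : ℕ) : diffMatrix n k 0 = of fun _ _ => (1 : ℝ) := by
  ext; simp [diffMatrix]

theorem wilsonMatrix_two (n k : ℕ) (hk : 2 ≤ k) : wilsonMatrix n k 2 =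
    ((n - k - 1).choose (k - 2) : ℝ)⁻¹ • diffMatrix n k (k - 1) -
      ((k - 1) * ((n - k - 2).choose (k - 2) : ℝ)⁻¹) • diffMatrix n k k := by
  obtain ⟨K, rfl⟩ := Nat.exists_eq_add_of_le' hk
  simp [wilsonMatrix, sum_range_succ]
  module

/-- For `0 < |A ∩ B|` other than `1` both `D_{k-1}` and `D_k` vanish at `(A, B)`; for disjoint `A`
and `B` the bound amounts to `n ≤ k ^ 2 - k + 1`. -/
theorem one_le_apply {n k : ℕ} (hk : 2 ≤ k) (hn : n ≤ k ^ 2 - k + 1)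
    {M : Matrix (KSubset n k) (KSubset n k) ℝ}
    (hM : M = of (fun _ _ => (1 : ℝ)) - ((n - 2).choose (k - 2) : ℝ) • wilsonMatrix n k 2)
    (A B : KSubset n k) (hAB : #(A.1 ∩ B.1) ≠ 1) : 1 ≤ M A B := by
  rw [hM, wilsonMatrix_two n k hk]
  simp only [Matrix.sub_apply, Matrix.smul_apply, of_apply, diffMatrix, smul_eq_mul, le_sub_self_iff]
  refine mul_nonpos_of_nonneg_of_nonpos (Nat.cast_nonneg _) ?_
  have hd := card_sdiff_add_card_inter A.1 B.1
  rw [A.2] at hd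
  rcases Nat.eq_zero_or_pos #(A.1 ∩ B.1) with h0 | h0
  · have hdis : Disjoint A.1 B.1 := by rwa [disjoint_iff_inter_eq_empty, ← card_eq_zero]
    have hn2 := card_le_univ (A.1 ∪ B.1)
    rw [card_union_of_disjoint hdis, A.2, B.2, Fintype.card_fin] at hn2
    -- Disjoint `k`-sets force `2 * k ≤ n`; with `k = K + 2` and `n = 2 * k + L` no subtraction
    -- truncates.
    obtain ⟨K, rfl⟩ := Nat.exists_eq_add_of_le' hk
    obtain ⟨L, rfl⟩ := Nat.exists_eq_add_of_le hn2
    have e1 : K + 2 + (K + 2) + L - (K + 2) - 1 = L + K + 1 := by omega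
    have e2 : K + 2 + (K + 2) + L - (K + 2) - 2 = L + K := by omega
    have e3 : #(A.1 \ B.1) = K + 2 := by omega
    have e4 : (K + 2) ^ 2 - (K + 2) + 1 = K ^ 2 + 3 * K + 3 := by
      have : (K + 2) ^ 2 = K ^ 2 + 3 * K + 2 + (K + 2) := by ring
      rw [this, Nat.add_sub_cancel]
    rw [e4] at hn
    rw [e1, e2, e3]
    have hc := Nat.choose_mul_succ_eq (L + K) K
    have e5 : L + K + 1 - K = L + 1 := by omega
    rw [e5] at hc
    have p1 : (0 : ℝ) < (L + K).choose K := by exact_mod_cast Nat.choose_pos (by omega)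
    have p2 : (0 : ℝ) < (L + K + 1).choose K := by exact_mod_cast Nat.choose_pos (by omega)
    have hc' : ((L + K).choose K : ℝ) * (L + K + 1) = (L + K + 1).choose K * (L + 1) := by
      exact_mod_cast hc
    have hn' : (K + 2 + (K + 2) + L : ℝ) ≤ K ^ 2 + 3 * K + 3 := by exact_mod_cast hn
    have e6 : (K + 2).choose (K + 2 - 1) = K + 2 := by simp
    rw [e6, Nat.choose_self, sub_nonpos]
    push_cast
    rw [inv_mul_eq_div, mul_one, ← div_eq_mul_inv, div_le_div_iff₀ p2 p1]
    have p3 : (0 : ℝ) < L + 1 := by positivity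
    refine le_of_mul_le_mul_right ?_ p3
    nlinarith
  · rw [Nat.choose_eq_zero_of_lt (show #(A.1 \ B.1) < k - 1 by omega),
      Nat.choose_eq_zero_of_lt (show #(A.1 \ B.1) < k by omega)]
    simp

/-! ### Eigenvalues of Wilson's matrix -/

theorem choose_add_left_succ_mul (L a : ℕ) :
    ((L + (a + 1)).choose L : ℝ) * (a + 1) = (L + a + 1) * (L + a).choose L := by
  have := Nat.add_one_mul_choose_eq (L + a) a
  rw [← Nat.choose_symm_add, add_assoc L, ← Nat.choose_symm_add] at this
  exact_mod_cast this.symm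

theorem choose_add_succ_succ_mul (L a : ℕ) :
    ((L + 1 + a).choose (L + 1) : ℝ) * (L + 1) = (L + 1 + a) * (L + a).choose L := by
  have := Nat.add_one_mul_choose_eq (L + a) L
  rw [show L + a + 1 = L + 1 + a by omega] at this
  exact_mod_cast this.symm

/-- With `k = K + 2`, `n = 2 * k + L` and `a = k - j`, this is, up to the sign `-(-1) ^ j`, the
eigenvalue of Wilson's matrix `A_2` in degree `j`, multiplied by the positive number
`(L + K).choose L * (L + 1 + K)`, which does not depend on `j`. -/
noncomputable def wilsonGap (K L a : ℕ) : ℝ :=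
  (L + a).choose L * ((K + 1) * (L + 1 + K) - a * (L + 1 + a))

theorem wilsonGap_nonneg {K L a : ℕ} (ha : a ≤ K) : 0 ≤ wilsonGap K L a := by
  refine mul_nonneg (Nat.cast_nonneg _) (sub_nonneg.2 ?_)
  have : (a : ℝ) ≤ K := by exact_mod_cast ha
  gcongr
  linarith

theorem wilsonGap_le_succ {K L a : ℕ} (hL : K ≤ L + 1) (ha : a + 3 ≤ K) :
    wilsonGap K L a ≤ wilsonGap K L (a + 1) := by
  obtain ⟨x, rfl⟩ := Nat.exists_eq_add_of_le ha
  -- In terms of the slacks `x` and `y` the difference of the two sides has nonnegative coefficients.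
  obtain ⟨y, hy⟩ := Nat.exists_eq_add_of_le hL
  obtain rfl : L = a + 2 + x + y := by omega
  have h := choose_add_left_succ_mul (a + 2 + x + y) a
  simp only [wilsonGap]
  set c := ((a + 2 + x + y + a).choose (a + 2 + x + y) : ℝ)
  set d := ((a + 2 + x + y + (a + 1)).choose (a + 2 + x + y) : ℝ)
  have hc : 0 ≤ c := Nat.cast_nonneg _
  have ha1 : (0 : ℝ) < a + 1 := by positivity
  refine le_of_mul_le_mul_right ?_ ha1
  rw [mul_right_comm d, h]
  push_cast
  rw [mul_assoc, mul_comm _ c, mul_assoc]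
  refine mul_le_mul_of_nonneg_left ?_ hc
  rw [← sub_nonneg]
  ring_nf
  positivity

/-- The extreme case of `wilsonGap_le`, with `K + 2` in place of `K`. It corresponds to the degree
`j = 4`, and is an equality for `K + 2 = L + 1`, that is, for `n = 3 * k - 3`. -/
theorem wilsonGap_sub_two_le {K L : ℕ} (hL : K + 2 ≤ L + 1) :
    wilsonGap (K + 2) L K ≤ (L + (K + 2)).choose L * (L + 1 + (K + 2)) := by
  obtain ⟨y, hy⟩ := Nat.exists_eq_add_of_le hL
  obtain rfl : L = K + 1 + y := by omega
  have h1 := choose_add_left_succ_mul (K + 1 + y) K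
  have h2 := choose_add_left_succ_mul (K + 1 + y) (K + 1)
  simp only [wilsonGap]
  rw [show K + 1 + 1 = K + 2 by rfl] at h2
  set c := ((K + 1 + y + K).choose (K + 1 + y) : ℝ)
  set d := ((K + 1 + y + (K + 1)).choose (K + 1 + y) : ℝ)
  set e := ((K + 1 + y + (K + 2)).choose (K + 1 + y) : ℝ)
  have hc : 0 ≤ c := Nat.cast_nonneg _
  push_cast at h1 h2 ⊢
  have h3 : e * ((K + 1 + 1) * (K + 1)) =
      c * ((K + 1 + y + (K + 1) + 1) * (K + 1 + y + K + 1)) := by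
    linear_combination (K + 1 : ℝ) * h2 + (K + 1 + y + (K + 1) + 1 : ℝ) * h1
  have hp : (0 : ℝ) < (K + 1 + 1) * (K + 1) := by positivity
  refine le_of_mul_le_mul_right ?_ hp
  rw [mul_right_comm e, h3, mul_assoc, mul_assoc]
  refine mul_le_mul_of_nonneg_left ?_ hc
  rw [← sub_nonneg]
  ring_nf
  positivity

/-- Since `wilsonGap K L a` increases with `a` up to `a = K - 2`, the extreme case is `a = K - 2`. -/
theorem wilsonGap_le {K L a : ℕ} (hL : K ≤ L + 1) (ha : a + 2 ≤ K) :
    wilsonGap K L a ≤ (L + K).choose L * (L + 1 + K) := by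
  induction h : K - (a + 2) generalizing a with
  | zero =>
    obtain rfl : K = a + 2 := by omega
    exact_mod_cast wilsonGap_sub_two_le hL
  | succ m ih =>
    exact (wilsonGap_le_succ hL (by omega)).trans (ih (by omega) (by omega))

/-- The eigenvalue of `wilsonMatrix n k 2` on the functions of degree `j` modulo those of lower
degree. -/
noncomputable def wilsonEigenvalue (n k j : ℕ) : ℝ :=
  ((n - k - 1).choose (k - 2) : ℝ)⁻¹ * diffEigenvalue n k (k - 1) j -
    ((k - 1) * ((n - k - 2).choose (k - 2) : ℝ)⁻¹) * diffEigenvalue n k k j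

theorem wilsonEigenvalue_eq {K L j : ℕ} (hj : j ≤ K + 2) :
    wilsonEigenvalue (2 * (K + 2) + L) (K + 2) j =
      -(-1) ^ j * wilsonGap K L (K + 2 - j) / ((L + K).choose L * (L + 1 + K)) := by
  obtain ⟨a, ha⟩ := Nat.exists_eq_add_of_le hj
  have e0 : K + 2 - j = a := by omega
  have e1 : 2 * (K + 2) + L - (K + 2) - 1 = L + 1 + K := by omega
  have e2 : 2 * (K + 2) + L - (K + 2) - 2 = L + K := by omega
  have e3 : 2 * (K + 2) + L - (K + 2 - 1) - j = L + 1 + a := by omega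
  have e4 : 2 * (K + 2) + L - (K + 2) - j = L + a := by omega
  have e5 : 2 * (K + 2) + L - (K + 2 - 1) - (K + 2) = L + 1 := by omega
  have e6 : 2 * (K + 2) + L - (K + 2) - (K + 2) = L := by omega
  have e7 : K + 2 - (K + 2 - 1) = 1 := by omega
  simp only [wilsonEigenvalue, wilsonGap, diffEigenvalue, e0, e1, e2, e3, e4, e5, e6, e7,
    Nat.add_sub_cancel, Nat.sub_self, Nat.choose_one_right, Nat.choose_zero_right]
  rw [← Nat.choose_symm_add (a := L + 1), ← Nat.choose_symm_add (a := L)]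
  have h1 := choose_add_succ_succ_mul L K
  have h2 := choose_add_succ_succ_mul L a
  have hL : (L + 1 : ℝ) ≠ 0 := by positivity
  have h3 : (L + 1 + K : ℝ) ≠ 0 := by positivity
  have h4 : ((L + K).choose L : ℝ) ≠ 0 := by exact_mod_cast (Nat.choose_pos (by omega)).ne'
  rw [← eq_div_iff hL] at h1 h2
  rw [h1, h2]
  push_cast
  field_simp
  ring

/-- The eigenvalue of `A_2` on the constants is `n.choose k / (n - 2).choose (k - 2) - 1`. -/
theorem wilsonEigenvalue_zero {K L : ℕ} :
    ((2 * (K + 2) + L - 2).choose (K + 2 - 2) : ℝ) *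
      wilsonEigenvalue (2 * (K + 2) + L) (K + 2) 0 =
      (2 * (K + 2) + L).choose (K + 2) - (2 * (K + 2) + L - 2).choose (K + 2 - 2) := by
  rw [wilsonEigenvalue_eq (Nat.zero_le _)]
  have e1 : 2 * (K + 2) + L - 2 = K + (K + 2 + L) := by omega
  have e2 : 2 * (K + 2) + L = K + (K + 2 + L) + 1 + 1 := by omega
  have h1 := choose_add_left_succ_mul L K
  have h2 := choose_add_left_succ_mul L (K + 1)
  have h3 : ((K + (K + 2 + L) + 1 : ℕ) : ℝ) * (K + (K + 2 + L)).choose K =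
      (K + (K + 2 + L) + 1).choose (K + 1) * (K + 1 : ℕ) := by
    exact_mod_cast Nat.add_one_mul_choose_eq (K + (K + 2 + L)) K
  have h4 : ((K + (K + 2 + L) + 1 + 1 : ℕ) : ℝ) * (K + (K + 2 + L) + 1).choose (K + 1) =
      (K + (K + 2 + L) + 1 + 1).choose (K + 2) * (K + 2 : ℕ) := by
    exact_mod_cast Nat.add_one_mul_choose_eq (K + (K + 2 + L) + 1) (K + 1)
  have h5 : ((L + K).choose L : ℝ) ≠ 0 := by exact_mod_cast (Nat.choose_pos (by omega)).ne'
  rw [e1, Nat.add_sub_cancel, Nat.sub_zero, e2, wilsonGap]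
  rw [show K + 1 + 1 = K + 2 by rfl] at h2
  generalize ((L + K).choose L : ℝ) = x at *
  generalize ((L + (K + 1)).choose L : ℝ) = y at *
  generalize ((L + (K + 2)).choose L : ℝ) = z at *
  generalize ((K + (K + 2 + L)).choose K : ℝ) = u at *
  generalize ((K + (K + 2 + L) + 1).choose (K + 1) : ℝ) = v at *
  generalize ((K + (K + 2 + L) + 1 + 1).choose (K + 2) : ℝ) = w at *
  push_cast at *
  have k1 : (K + 1 : ℝ) ≠ 0 := by positivity
  have k2 : (K + 2 : ℝ) ≠ 0 := by positivity
  have k2' : (K + 1 + 1 : ℝ) ≠ 0 := by positivity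
  have h6 : (L + 1 + K : ℝ) ≠ 0 := by positivity
  obtain rfl := eq_div_of_mul_eq k1 h1
  obtain rfl := eq_div_of_mul_eq k2' h2
  obtain rfl := eq_div_of_mul_eq k1 h3.symm
  obtain rfl := eq_div_of_mul_eq k2 h4.symm
  field_simp
  ring

/-- The eigenvalue is `-1` in degrees `1` and `2`, nonnegative in odd degrees from `3` on, and at
least `-1` in even degrees from `4` on by `wilsonGap_le`. -/
theorem neg_one_le_wilsonEigenvalue {K L j : ℕ} (hL : K ≤ L + 1) (hj0 : j ≠ 0) (hj : j ≤ K + 2) :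
    -1 ≤ wilsonEigenvalue (2 * (K + 2) + L) (K + 2) j := by
  rw [wilsonEigenvalue_eq hj]
  have hp : (0 : ℝ) < (L + K).choose L * (L + 1 + K) :=
    mul_pos (by exact_mod_cast Nat.choose_pos (by omega)) (by positivity)
  rw [le_div_iff₀ hp]
  rcases Nat.even_or_odd j with he | ho
  · rw [he.neg_one_pow]
    suffices wilsonGap K L (K + 2 - j) ≤ (L + K).choose L * (L + 1 + K) by linarith
    obtain rfl | h : j = 2 ∨ 4 ≤ j := by
      obtain ⟨i, rfl⟩ := he; omega
    · rw [Nat.add_sub_cancel, wilsonGap]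
      refine mul_le_mul_of_nonneg_left ?_ (Nat.cast_nonneg _)
      linarith
    · exact wilsonGap_le hL (by omega)
  · rw [ho.neg_one_pow]
    obtain rfl | h : j = 1 ∨ 2 ≤ j := by omega
    · have h1 := choose_add_left_succ_mul L K
      rw [show K + 2 - 1 = K + 1 by omega, wilsonGap]
      push_cast
      linear_combination h1
    · have := wilsonGap_nonneg (L := L) (show K + 2 - j ≤ K by omega)
      linarith

/-! ### The largest eigenvalue -/

theorem isLargestEigenvalue_one {V : Type*} [Fintype V] [DecidableEq V] [Nonempty V] :
    IsLargestEigenvalue (1 : Matrix V V ℝ) 1 := by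
  constructor
  · refine Module.End.hasEigenvalue_of_hasEigenvector (x := fun _ => 1)
      ⟨Module.End.mem_eigenspace_iff.2 (by simp), ?_⟩
    exact fun h => one_ne_zero (congrFun h (Classical.arbitrary V))
  · intro μ hμ
    obtain ⟨v, hv⟩ := hμ.exists_hasEigenvector
    have := hv.apply_eq_smul
    rw [toLin'_one, LinearMap.id_apply] at this
    have h : (1 - μ) • v = 0 := by rw [sub_smul, ← this, one_smul, sub_self]
    rcases smul_eq_zero.1 h with h | h
    · linarith
    · exact absurd h hv.2

theorem sub_wilsonMatrix_two_eq_one (n : ℕ) :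
    of (fun _ _ => (1 : ℝ)) - ((n - 2).choose (2 - 2) : ℝ) • wilsonMatrix n 2 2 = 1 := by
  ext A B
  rw [wilsonMatrix_two n 2 le_rfl]
  have h : #(A.1 \ B.1) ≤ 2 := (card_le_card sdiff_subset).trans A.2.le
  have hAB : A = B ↔ #(A.1 \ B.1) = 0 := by
    rw [card_eq_zero, sdiff_eq_empty_iff_subset]
    exact ⟨fun h => h ▸ le_rfl,
      fun h => Subtype.ext (eq_of_subset_of_card_le h (by rw [A.2, B.2]))⟩
  rw [one_apply]
  simp only [hAB]
  simp only [Matrix.sub_apply, Matrix.smul_apply, of_apply, diffMatrix, smul_eq_mul, Nat.sub_self,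
    Nat.choose_zero_right]
  interval_cases #(A.1 \ B.1) <;> norm_num

/-- The matrix is triangular with respect to the degree. Its diagonal entry in degree `0` is
`(n - 2).choose (k - 2)`, with the constants as eigenvectors, and in degree `j > 0`, where the
all-ones matrix contributes nothing, it is `-(n - 2).choose (k - 2)` times the eigenvalue of `A_2`. -/
theorem isLargestEigenvalue_sub_wilsonMatrix {n k : ℕ} (hk : 2 ≤ k) (hn : 3 * k - 3 ≤ n) :
    IsLargestEigenvalue (of (fun _ _ => (1 : ℝ)) -
      ((n - 2).choose (k - 2) : ℝ) • wilsonMatrix n k 2) ((n - 2).choose (k - 2) : ℝ) := by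
  obtain ⟨S, -, hS⟩ := exists_subset_card_eq (s := (univ : Finset (Fin n))) (n := k)
    (by rw [Finset.card_univ, Fintype.card_fin]; omega)
  have : Nonempty (KSubset n k) := ⟨⟨S, hS⟩⟩
  obtain rfl | hk3 : k = 2 ∨ 3 ≤ k := by omega
  -- For `k = 2` the value `n = 3 < 2 * k` is allowed, where the triangular form is not available.
  · rw [sub_wilsonMatrix_two_eq_one]
    simpa using isLargestEigenvalue_one
  set C : ℝ := Nat.cast ((n - 2).choose (k - 2))
  set M : Matrix (KSubset n k) (KSubset n k) ℝ := of (fun _ _ => (1 : ℝ)) - C • wilsonMatrix n k 2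
    with hM
  set c : ℕ → ℝ := fun j => diffEigenvalue n k 0 j - C * wilsonEigenvalue n k j with hc
  obtain ⟨K, rfl⟩ := Nat.exists_eq_add_of_le' hk
  obtain ⟨L, rfl⟩ := Nat.exists_eq_add_of_le (show 2 * (K + 2) ≤ n by omega)
  have hMS : ∀ S, M *ᵥ containIndicator _ _ S - c #S • containIndicator _ _ S ∈
      degreeLTSubmodule (2 * (K + 2) + L) (K + 2) #S := by
    intro S
    have h0 := diffMatrix_mulVec_containIndicator_sub_mem (n := 2 * (K + 2) + L) (k := K + 2)
      (s := 0) (by omega) (by omega) S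
    have h1 := diffMatrix_mulVec_containIndicator_sub_mem (n := 2 * (K + 2) + L) (k := K + 2)
      (s := K + 2 - 1) (by omega) (by omega) S
    have h2 := diffMatrix_mulVec_containIndicator_sub_mem (n := 2 * (K + 2) + L) (k := K + 2)
      (s := K + 2) (by omega) (by omega) S
    rw [hM, wilsonMatrix_two _ _ hk, ← diffMatrix_zero]
    simp only [hc, wilsonEigenvalue, sub_mulVec, smul_mulVec]
    generalize (Nat.cast ((2 * (K + 2) + L - (K + 2) - 1).choose (K + 2 - 2)) : ℝ)⁻¹ = a
    generalize (Nat.cast (K + 2) - 1 : ℝ) *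
      (Nat.cast ((2 * (K + 2) + L - (K + 2) - 2).choose (K + 2 - 2)) : ℝ)⁻¹ = b
    convert sub_mem h0 (Submodule.smul_mem _ C (sub_mem (Submodule.smul_mem _ a h1)
      (Submodule.smul_mem _ b h2))) using 1
    module
  have hf : ∀ j < K + 2 + 1, ∀ x ∈ degreeLTSubmodule (2 * (K + 2) + L) (K + 2) (j + 1),
      toLin' M x - c j • x ∈ degreeLTSubmodule (2 * (K + 2) + L) (K + 2) j :=
    fun j _ x hx => mulVec_sub_smul_mem_degreeLTSubmodule hMS hx
  have hc0 : c 0 = C := by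
    simp only [hc, C]
    rw [wilsonEigenvalue_zero]
    have e : 2 * (K + 2) + L - (K + 2) = K + 2 + L := by omega
    have := Nat.choose_symm_of_eq_add (show 2 * (K + 2) + L = K + 2 + (K + 2 + L) by ring)
    simp [diffEigenvalue, e, this]
  constructor
  · refine Module.End.hasEigenvalue_of_hasEigenvector (x := containIndicator _ _ ∅)
      ⟨Module.End.mem_eigenspace_iff.2 ?_, ?_⟩
    · have := hf 0 (by omega) _ (containIndicator_mem (S := ∅) (by simp))
      rw [degreeLTSubmodule_zero, Submodule.mem_bot, sub_eq_zero, hc0] at this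
      exact this
    · intro h
      simpa [containIndicator] using congrFun h ⟨S, hS⟩
  · intro μ hμ
    obtain ⟨j, hj, rfl⟩ := hμ.exists_eq_of_filtration (degreeLTSubmodule_zero _ _)
      (degreeLTSubmodule_eq_top _ _) hf
    rcases Nat.eq_zero_or_pos j with rfl | hj0
    · exact hc0.le
    · have h1 := neg_one_le_wilsonEigenvalue (K := K) (L := L) (by omega) hj0.ne' (by omega)
      have h2 : diffEigenvalue (2 * (K + 2) + L) (K + 2) 0 j = 0 := by
        simp only [diffEigenvalue]
        rw [Nat.choose_eq_zero_of_lt (show K + 2 - j < K + 2 - 0 by omega)]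
        simp
      have h3 : 0 ≤ C := Nat.cast_nonneg _
      simp only [hc, h2]
      nlinarith

/-! ### The Delsarte number -/

/-- The trace of a feasible matrix is at least the number of vertices, and at most that number times
the largest eigenvalue. -/
theorem one_le_of_isLargestEigenvalue {V : Type*} [Fintype V] [DecidableEq V] [Nonempty V]
    {G : SimpleGraph V} {A : Matrix V V ℝ} {c : ℝ} (hA : IsDelsarteFeasible G A)
    (hc : IsLargestEigenvalue A c) : 1 ≤ c := by
  have hH : A.IsHermitian := by
    rw [Matrix.IsHermitian, conjTranspose_eq_transpose_of_trivial]; exact hA.1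
  have h1 : (Fintype.card V : ℝ) ≤ A.trace := by
    rw [trace, ← Finset.card_univ, ← nsmul_one]
    exact card_nsmul_le_sum _ _ _ fun i _ => hA.2 i i (G.loopless.irrefl i)
  have h2 : A.trace ≤ Fintype.card V * c := by
    rw [hH.trace_eq_sum_eigenvalues, ← Finset.card_univ, ← nsmul_eq_mul]
    refine sum_le_card_nsmul _ _ _ fun i _ => hc.2 ?_
    have := hH.eigenvalues_mem_spectrum_real i
    rw [← Matrix.spectrum_toLin'] at this
    exact Module.End.hasEigenvalue_iff_mem_spectrum.2 this
  have h3 : (0 : ℝ) < Fintype.card V := by exact_mod_cast Fintype.card_pos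
  nlinarith

/-- The set in the definition of `delsarteNumber` is bounded below by `1`, so that its infimum is not
the junk value of an unbounded set. -/
theorem delsarteNumber_le {V : Type*} [Fintype V] [DecidableEq V] [Nonempty V]
    {G : SimpleGraph V} {A : Matrix V V ℝ} {c : ℝ} (hA : IsDelsarteFeasible G A)
    (hc : IsLargestEigenvalue A c) : delsarteNumber G ≤ c :=
  csInf_le ⟨1, fun _ ⟨_, hB, hd⟩ => one_le_of_isLargestEigenvalue hB hd⟩ ⟨A, hA, hc⟩

theorem singleJohnsonGraph_adj_iff {n k : ℕ} {l : ℕ} (hl : l < k) {A B : KSubset n k} :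
    (singleJohnsonGraph n k l).Adj A B ↔ #(A.1 ∩ B.1) = l := by
  have h : A ≠ B ↔ #(A.1 ∩ B.1) < k := by
    rw [← not_iff_not, not_not, not_lt]
    constructor
    · rintro rfl; simp [A.2]
    · intro h
      have hA := eq_of_subset_of_card_le (inter_subset_left (s₁ := A.1) (s₂ := B.1))
        (by rw [A.2]; exact h)
      have hB := eq_of_subset_of_card_le (inter_subset_right (s₁ := A.1) (s₂ := B.1))
        (by rw [B.2]; exact h)
      exact Subtype.ext (hA.symm.trans hB)
  simp only [singleJohnsonGraph, generalizedJohnsonGraph, h, Set.mem_sdiff, Set.mem_Iio,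
    Set.mem_singleton_iff]
  omega

theorem mainTheorem2 (n k : ℕ) (hk : 2 ≤ k)
    (M : Matrix (KSubset n k) (KSubset n k) ℝ)
    (hM : M = Matrix.of (fun _ _ => (1 : ℝ)) - ((n - 2).choose (k - 2) : ℝ) • wilsonMatrix n k 2) :
    (n ≤ k ^ 2 - k + 1 →
      ∀ A B : KSubset n k, (A.1 ∩ B.1).card ≠ 1 → 1 ≤ M A B) ∧
    (3 * k - 3 ≤ n → IsLargestEigenvalue M ((n - 2).choose (k - 2) : ℝ)) ∧
    (n ≤ k ^ 2 - k + 1 → IsDelsarteFeasible (singleJohnsonGraph n k 1) M) ∧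
    (3 * k - 3 ≤ n → n ≤ k ^ 2 - k + 1 →
      delsarteNumber (singleJohnsonGraph n k 1) ≤ ((n - 2).choose (k - 2) : ℝ)) := by
  have hentry : n ≤ k ^ 2 - k + 1 → ∀ A B : KSubset n k, #(A.1 ∩ B.1) ≠ 1 → 1 ≤ M A B :=
    fun hn A B => one_le_apply hk hn hM A B
  have heig : 3 * k - 3 ≤ n → IsLargestEigenvalue M ((n - 2).choose (k - 2) : ℝ) :=
    fun hn => hM ▸ isLargestEigenvalue_sub_wilsonMatrix hk hn
  have hfeas : n ≤ k ^ 2 - k + 1 → IsDelsarteFeasible (singleJohnsonGraph n k 1) M := by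
    refine fun hn => ⟨?_, fun A B h => hentry hn A B ?_⟩
    · rw [hM, wilsonMatrix_two n k hk, ← diffMatrix_zero]
      exact (diffMatrix_isSymm _ _ _).sub
        ((((diffMatrix_isSymm _ _ _).smul _).sub ((diffMatrix_isSymm _ _ _).smul _)).smul _)
    · rwa [singleJohnsonGraph_adj_iff (by omega)] at h
  refine ⟨hentry, heig, hfeas, fun hn hn' => ?_⟩
  obtain ⟨S, -, hS⟩ := exists_subset_card_eq (s := (univ : Finset (Fin n))) (n := k)
    (by rw [Finset.card_univ, Fintype.card_fin]; omega)
  have : Nonempty (KSubset n k) := ⟨⟨S, hS⟩⟩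
  exact delsarteNumber_le (hfeas hn') (heig hn)
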